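/- An operator space is a (closed) linear subspace $X\subset B(H)$ of the bounded operators on a complex Hilbert space $H$; for $N\ge1$, $M_N(X)$ (the $N\times N$ matrices with entries in $X$) carries the norm inherited from $M_N(B(H))=B(H\oplus\cdots\oplus H)$. For a linear map $u:E\to F$ between operator spaces let $u_N=\mathrm{Id}\otimes u:M_N(E)\to M_N(F)$, and let $d_N(E,F)=\inf\|u_N\|\,\|(u^{-1})_N\|$, the infimum being over all isomorphisms $u:E\to F$ (and $d_N(E,F)=\infty$ if there are none). For a finite dimensional operator space $E$, $N\ge 1$ and $C>0$, let $k_E(N,C)$ be the smallest integer $k\ge1$ such that there is a subspace $F$ of $M_N\oplus\cdots\oplus M_N$ ($k$ copies of the complex $N\times N$ matrices, acting block-diagonally) with $d_N(E,F)\le C$ (and $k_E(N,C)=\infty$ if there is no such $k$). (i) If $E$ is an $n$-dimensional operator space, then for all $0<\delta<1$ and all $N\ge1$ $$k_E\big(N,(1-\delta)^{-1}\big)\le (1+2\delta^{-1})^{2nN^2}.$$ (ii) Therefore, for every operator space $X$, every finite dimensional subspace $E\subset X$ and every $C>1$, $$\limsup_{N\to\infty}\frac{\log k_E(N,C)}{N^2}<\infty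 .$$ (iii) Growth of order $\exp(b\,nN^2)$ is therefore the largest possible: for every $C>1$ there is a number $b>0$, depending only on $C$, such that $k_E(N,C)\le \exp(b\,nN^2)$ for all $n$, all $n$-dimensional operator spaces $E$ and all $N\ge1$. -/

import Mathlib

open scoped ENNReal

universe u v

namespace OpSpace


/-- The bounded operators on a Hilbert space. An operator space is a subspace of some `B H`. -/
abbrev B (H : Type u) [NormedAddCommGroup H] [InnerProductSpace ℂ H] : Type u := H →L[ℂ] H

/-- The Hilbert space direct sum of `N` copies of `H`. -/
abbrev HPow (N : ℕ) (H : Type u) [NormedAddCommGroup H] [InnerProductSpace ℂ H] : Type u :=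
  PiLp 2 (fun _ : Fin N => H)

section

variable {H : Type u} [NormedAddCommGroup H] [InnerProductSpace ℂ H]
variable {K : Type v} [NormedAddCommGroup K] [InnerProductSpace ℂ K]

/-- The operator on `H ⊕ ⋯ ⊕ H` given by an `N × N` matrix with entries in `B H`. -/
noncomputable def matOp {N : ℕ} (x : Matrix (Fin N) (Fin N) (B H)) : B (HPow N H) :=
  ((PiLp.continuousLinearEquiv 2 ℂ (fun _ : Fin N => H)).symm :
      (Fin N → H) →L[ℂ] HPow N H).comp
    (ContinuousLinearMap.pi fun i => ∑ j, (x i j).comp (PiLp.proj 2 (fun _ : Fin N => H) j))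

theorem matOp_apply {N : ℕ} (x : Matrix (Fin N) (Fin N) (B H)) (ξ : HPow N H) (i : Fin N) :
    matOp x ξ i = ∑ j, x i j (ξ j) := by
  simp [matOp]

/-- The norm of `M_N(E)` for an operator space `E ⊆ B H`, inherited from
`M_N(B H) = B (H ⊕ ⋯ ⊕ H)`. -/
noncomputable def matNorm {E : Submodule ℂ (B H)} {N : ℕ} (x : Matrix (Fin N) (Fin N) E) : ℝ :=
  ‖matOp (x.map fun e => (e : B H))‖

/-- The norm of `u_N = Id ⊗ u : M_N(E) → M_N(F)`, the map that applies `u` to each entry. -/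
noncomputable def ampNorm {E : Submodule ℂ (B H)} {F : Submodule ℂ (B K)} (N : ℕ)
    (u : E →L[ℂ] F) : ℝ≥0∞ :=
  ⨆ (x : Matrix (Fin N) (Fin N) E) (_ : matNorm x ≤ 1), ENNReal.ofReal (matNorm (x.map u))

/-- `d_N(E, F)`: the infimum of `‖u_N‖ ‖(u⁻¹)_N‖` over all isomorphisms `u : E → F`,
which is `∞` if there are none. -/
noncomputable def dist (N : ℕ) (E : Submodule ℂ (B H)) (F : Submodule ℂ (B K)) : ℝ≥0∞ :=
  ⨅ u : E ≃L[ℂ] F, ampNorm N (u : E →L[ℂ] F) * ampNorm N (u.symm : F →L[ℂ] E)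

end

/-- The Hilbert space on which the direct sum of `k` copies of `M_N` acts. -/
abbrev SumSpace (N k : ℕ) : Type := HPow k (EuclideanSpace ℂ (Fin N))

/-- The operator space `M_N ⊕ ⋯ ⊕ M_N` (`k` summands), as the space of
block diagonal operators. -/
def matSum (N k : ℕ) : Submodule ℂ (B (SumSpace N k)) where
  carrier := {T | ∃ a : Fin k → B (EuclideanSpace ℂ (Fin N)), ∀ ξ i, T ξ i = a i (ξ i)}
  zero_mem' := ⟨0, by simp⟩
  add_mem' := by
    rintro S T ⟨a, ha⟩ ⟨b, hb⟩
    exact ⟨a + b, fun ξ i => by simp [ha, hb]⟩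
  smul_mem' := by
    rintro c T ⟨a, ha⟩
    exact ⟨c • a, fun ξ i => by simp [ha]⟩

/-- `k_E(N, C)`: the smallest integer `k ≥ 1` such that `d_N(E, F) ≤ C` for some subspace `F` of
the direct sum of `k` copies of `M_N`; it is `∞` if there is none. -/
noncomputable def kE {H : Type u} [NormedAddCommGroup H] [InnerProductSpace ℂ H]
    (E : Submodule ℂ (B H)) (N : ℕ) (C : ℝ) : ℕ∞ :=
  ⨅ (k : ℕ) (_ : 1 ≤ k ∧ ∃ F : Submodule ℂ (B (SumSpace N k)),
      F ≤ matSum N k ∧ dist N E F ≤ ENNReal.ofReal C), (k : ℕ∞)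

end OpSpace

/-! The norm of an `N × N` matrix over `B H` is nearly attained at some `ξ ∈ H^N`. The `N`
coordinates of `ξ` and those of its image each span a space of dimension at most `N`, so compressing
all entries to `ℂ^N` loses almost none of the norm (`exists_compression`). Take one such compression
for each point of a finite net of the unit sphere of `M_N(E)`. Their direct sum maps `E` into copies
of `M_N`, is contractive on `M_N(E)`, and is bounded below by `1 - δ` on that sphere
(`kE_le_of_net`). A volume count bounds the net (`exists_sphere_net`): `M_N(E)` has real dimension
`2nN²`, whence the exponent. The other two claims follow with `δ = 1 - C⁻¹`. -/

namespace OpSpace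

/-! ### Nets of the unit sphere in a finite dimensional real normed space -/

section Net

open Metric MeasureTheory Module

variable {V : Type*} [NormedAddCommGroup V] [NormedSpace ℝ V] [FiniteDimensional ℝ V]

/-- The volume bound for the cardinality of a `δ`-separated subset of the unit ball. -/
theorem card_le_of_separated {δ : ℝ} (hδ : 0 < δ) (s : Finset V) (hs : ∀ c ∈ s, ‖c‖ ≤ 1)
    (h : ∀ c ∈ s, ∀ d ∈ s, c ≠ d → δ ≤ ‖c - d‖) :
    (s.card : ℝ) ≤ (1 + 2 * δ⁻¹) ^ finrank ℝ V := by
  borelize V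
  let μ : Measure V := Measure.addHaar
  have hr : 0 < δ / 2 := by positivity
  have hρ : 0 < 1 + δ / 2 := by positivity
  have D : Set.Pairwise (s : Set V) (Function.onFun Disjoint fun c => ball (c : V) (δ / 2)) := by
    intro c hc d hd hcd
    apply ball_disjoint_ball
    rw [dist_eq_norm, add_halves]
    exact h c hc d hd hcd
  have A_subset : (⋃ c ∈ s, ball (c : V) (δ / 2)) ⊆ ball (0 : V) (1 + δ / 2) := by
    refine Set.iUnion₂_subset fun x hx => ball_subset_ball' ?_
    rw [dist_zero_right]
    linarith [hs x hx]
  have I : (s.card : ℝ≥0∞) * ENNReal.ofReal ((δ / 2) ^ finrank ℝ V) * μ (ball 0 1) ≤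
      ENNReal.ofReal ((1 + δ / 2) ^ finrank ℝ V) * μ (ball 0 1) := by
    have := measure_mono (μ := μ) A_subset
    rw [measure_biUnion_finset D fun c _ => measurableSet_ball] at this
    simpa only [μ.addHaar_ball_of_pos _ hr, μ.addHaar_ball_of_pos _ hρ, Finset.sum_const,
      nsmul_eq_mul, mul_assoc] using this
  have J := (ENNReal.mul_le_mul_iff_left (measure_ball_pos _ _ zero_lt_one).ne'
    measure_ball_lt_top.ne).1 I
  have K := ENNReal.toReal_le_of_le_ofReal (pow_nonneg hρ.le _) J
  rw [ENNReal.toReal_mul, ENNReal.toReal_natCast, ENNReal.toReal_ofReal (by positivity),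
    ← le_div_iff₀ (by positivity), ← div_pow] at K
  rwa [show 1 + 2 * δ⁻¹ = (1 + δ / 2) / (δ / 2) by field_simp; ring]

/-- The unit sphere has a net of cardinality at most `(1 + 2 / δ) ^ dim` and of mesh strictly
less than `δ`. -/
theorem exists_sphere_net {δ : ℝ} (hδ : 0 < δ) :
    ∃ (s : Finset V) (r : ℝ), r < δ ∧ (∀ c ∈ s, ‖c‖ = 1) ∧
      (∀ x : V, ‖x‖ = 1 → ∃ c ∈ s, ‖x - c‖ ≤ r) ∧
      (s.card : ℝ) ≤ (1 + 2 * δ⁻¹) ^ finrank ℝ V := by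
  classical
  let P : Finset V → Prop := fun s => (∀ c ∈ s, ‖c‖ = 1) ∧
    ∀ c ∈ s, ∀ d ∈ s, c ≠ d → δ ≤ ‖c - d‖
  have hcard : ∀ s, P s → (s.card : ℝ) ≤ (1 + 2 * δ⁻¹) ^ finrank ℝ V := fun s hs =>
    card_le_of_separated hδ s (fun c hc => (hs.1 c hc).le) hs.2
  obtain ⟨s, hs, hmax⟩ : ∃ s, P s ∧ ∀ t, P t → t.card ≤ s.card := by
    have hb : BddAbove (Set.image Finset.card {s | P s}) := by
      refine ⟨⌊(1 + 2 * δ⁻¹) ^ finrank ℝ V⌋₊, ?_⟩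
      rintro _ ⟨s, hs, rfl⟩
      exact Nat.le_floor (hcard s hs)
    obtain ⟨s, hs, h⟩ := Nat.sSup_mem (s := Set.image Finset.card {s | P s}) ⟨0, ∅, by simp [P], rfl⟩ hb
    exact ⟨s, hs, fun t ht => h ▸ le_csSup hb ⟨t, ht, rfl⟩⟩
  have hnet : ∀ x : V, ‖x‖ = 1 → ∃ c ∈ s, ‖x - c‖ < δ := by
    intro x hx
    by_contra! hcon
    have hxs : x ∉ s := fun hxs => by simpa using (hcon x hxs).trans_lt' hδ
    have := hmax (insert x s) (by
      refine ⟨by simpa [hx] using hs.1, ?_⟩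
      intro c hc d hd hcd
      rcases Finset.mem_insert.1 hc with rfl | hc' <;>
        rcases Finset.mem_insert.1 hd with rfl | hd'
      · exact absurd rfl hcd
      · exact hcon d hd'
      · rw [norm_sub_rev]; exact hcon c hc'
      · exact hs.2 c hc' d hd' hcd)
    rw [Finset.card_insert_of_notMem hxs] at this
    omega
  rcases (sphere (0 : V) 1).eq_empty_or_nonempty with he | hne
  · refine ⟨s, 0, hδ, hs.1, fun x hx => ?_, hcard s hs⟩
    exact absurd (show x ∈ sphere (0 : V) 1 by simpa using hx) (by simp [he])
  -- Compactness makes the mesh uniform: the distance to `s` attains its maximum over the sphere,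
  -- and this maximum is below `δ`. The gap `δ - r` is needed later, since norms need not be
  -- attained.
  obtain ⟨y, hy, hymax⟩ := (isCompact_sphere (0 : V) 1).exists_isMaxOn hne
    (continuous_infDist_pt (s : Set V)).continuousOn
  have hy1 : ‖y‖ = 1 := by simpa using hy
  obtain ⟨c, hc, hcy⟩ := hnet y hy1
  refine ⟨s, infDist y s, ?_, hs.1, fun x hx => ?_, hcard s hs⟩
  · rw [← dist_eq_norm] at hcy
    exact (infDist_le_dist_of_mem (Finset.mem_coe.2 hc)).trans_lt hcy
  · obtain ⟨d, hd, hxd⟩ := s.finite_toSet.isCompact.exists_infDist_eq_dist ⟨c, hc⟩ x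
    refine ⟨d, hd, ?_⟩
    rw [← dist_eq_norm, ← hxd]
    exact hymax (by simpa using hx)

end Net

/-! ### Compression of matrices over `B H` to matrices over `M_N` -/

section Compression

variable {H : Type u} [NormedAddCommGroup H] [InnerProductSpace ℂ H]
variable {K : Type v} [NormedAddCommGroup K] [InnerProductSpace ℂ K]

/-- Any `N` vectors of a Hilbert space factor through `ℂ ^ N` by contractions. -/
theorem exists_contractions_fixing {N : ℕ} (ξ : Fin N → H) :
    ∃ (R : H →L[ℂ] EuclideanSpace ℂ (Fin N)) (V : EuclideanSpace ℂ (Fin N) →L[ℂ] H),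
      (∀ x, ‖R x‖ ≤ ‖x‖) ∧ (∀ x, ‖V x‖ ≤ ‖x‖) ∧ ∀ q, V (R (ξ q)) = ξ q := by
  let S : Submodule ℂ H := Submodule.span ℂ (Set.range ξ)
  have : FiniteDimensional ℂ S := FiniteDimensional.span_of_finite ℂ (Set.finite_range ξ)
  have hm : Module.finrank ℂ S ≤ N :=
    (finrank_range_le_card (R := ℂ) ξ).trans_eq (Fintype.card_fin N)
  let b := stdOrthonormalBasis ℂ S
  have ho : Orthonormal ℂ fun i : Fin (Module.finrank ℂ S) =>
      EuclideanSpace.basisFun (Fin N) ℂ (Fin.castLE hm i) :=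
    (EuclideanSpace.basisFun (Fin N) ℂ).orthonormal.comp _ (Fin.castLE_injective hm)
  let L : S →ₗᵢ[ℂ] EuclideanSpace ℂ (Fin N) :=
    (b.toBasis.constr ℂ fun i => EuclideanSpace.basisFun (Fin N) ℂ
      (Fin.castLE hm i)).isometryOfOrthonormal (v := b.toBasis) (by simp)
      (by convert ho using 1; ext1 i; simp only [Function.comp_apply, Module.Basis.constr_basis])
  -- With `P` the projection onto the span `S` and `L : S → ℂ^N` isometric, `R = L P` and `V = L*`,
  -- so `V R = P` fixes `S`.
  refine ⟨L.toContinuousLinearMap.comp S.orthogonalProjectionOnto,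
    S.subtypeL.comp (ContinuousLinearMap.adjoint L.toContinuousLinearMap), ?_, ?_, ?_⟩
  · intro x
    simpa using S.norm_orthogonalProjectionOnto_apply_le x
  · intro x
    refine (ContinuousLinearMap.le_opNorm _ x).trans ?_
    refine mul_le_of_le_one_left (norm_nonneg x) ?_
    refine (ContinuousLinearMap.opNorm_comp_le _ _).trans ?_
    rw [LinearIsometryEquiv.norm_map]
    exact mul_le_one₀ (Submodule.norm_subtypeL_le S) (norm_nonneg _) L.norm_toContinuousLinearMap_le
  · intro q
    have hq : ξ q ∈ S := Submodule.subset_span ⟨q, rfl⟩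
    have h1 : S.orthogonalProjectionOnto (ξ q) = ⟨ξ q, hq⟩ :=
      S.orthogonalProjectionOnto_mem_subspace_eq_self ⟨ξ q, hq⟩
    have h2 : (ContinuousLinearMap.adjoint L.toContinuousLinearMap) (L ⟨ξ q, hq⟩) = ⟨ξ q, hq⟩ := by
      refine ext_inner_right ℂ fun w => ?_
      rw [ContinuousLinearMap.adjoint_inner_left]
      exact L.inner_map_map _ _
    simp only [ContinuousLinearMap.comp_apply, h1, LinearIsometry.coe_toContinuousLinearMap, h2]
    rfl

/-- Compressing all entries of a matrix by contractions does not increase its norm. -/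
theorem norm_matOp_compress_le {N : ℕ} (x : Matrix (Fin N) (Fin N) (B H)) (R : H →L[ℂ] K)
    (V : K →L[ℂ] H) (hR : ∀ x, ‖R x‖ ≤ ‖x‖) (hV : ∀ x, ‖V x‖ ≤ ‖x‖) :
    ‖matOp (x.map fun e => R.comp (e.comp V))‖ ≤ ‖matOp x‖ := by
  refine ContinuousLinearMap.opNorm_le_bound _ (norm_nonneg _) fun ζ => ?_
  let ξ : HPow N H := WithLp.toLp 2 fun q => V (ζ q)
  have hξ : ‖ξ‖ ≤ ‖ζ‖ := by
    rw [PiLp.norm_eq_of_L2, PiLp.norm_eq_of_L2]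
    gcongr with q
    exact hV _
  have h : ‖matOp (x.map fun e => R.comp (e.comp V)) ζ‖ ≤ ‖matOp x ξ‖ := by
    rw [PiLp.norm_eq_of_L2, PiLp.norm_eq_of_L2]
    gcongr with p
    rw [matOp_apply, matOp_apply]
    simpa [ξ, ← map_sum] using hR (∑ q, x p q (V (ζ q)))
  calc _ ≤ ‖matOp x ξ‖ := h
    _ ≤ ‖matOp x‖ * ‖ξ‖ := (matOp x).le_opNorm ξ
    _ ≤ _ := by gcongr

/-- Compressions to `ℂ ^ N` detect the norm of an `N × N` matrix. -/
theorem exists_compression {N : ℕ} (x : Matrix (Fin N) (Fin N) (B H)) {c : ℝ}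
    (hc : c < ‖matOp x‖) :
    ∃ (R : H →L[ℂ] EuclideanSpace ℂ (Fin N)) (V : EuclideanSpace ℂ (Fin N) →L[ℂ] H),
      (∀ x, ‖R x‖ ≤ ‖x‖) ∧ (∀ x, ‖V x‖ ≤ ‖x‖) ∧
        c ≤ ‖matOp (x.map fun e => R.comp (e.comp V))‖ := by
  rcases lt_or_ge c 0 with h0 | h0
  · exact ⟨0, 0, by simp, by simp, h0.le.trans (norm_nonneg _)⟩
  obtain ⟨ξ, hξ⟩ : ∃ ξ, c * ‖ξ‖ < ‖matOp x ξ‖ := by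
    by_contra! h
    exact hc.not_ge (ContinuousLinearMap.opNorm_le_bound _ h0 h)
  -- The first pair handles the input vectors, the second the output vectors. Only `V₁` and `R₂`
  -- enter the compression; `R₁` transports `ξ`, and `V₂` shows that `R₂` does not shrink the
  -- outputs.
  obtain ⟨R₁, V₁, hR₁, hV₁, h₁⟩ := exists_contractions_fixing fun q => ξ q
  obtain ⟨R₂, V₂, hR₂, hV₂, h₂⟩ := exists_contractions_fixing fun q => matOp x ξ q
  refine ⟨R₂, V₁, hR₂, hV₁, ?_⟩
  let ζ : HPow N (EuclideanSpace ℂ (Fin N)) := WithLp.toLp 2 fun q => R₁ (ξ q)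
  have hζ : ‖ζ‖ ≤ ‖ξ‖ := by
    rw [PiLp.norm_eq_of_L2, PiLp.norm_eq_of_L2]
    gcongr with q
    exact hR₁ _
  have hle : ‖matOp x ξ‖ ≤ ‖matOp (x.map fun e => R₂.comp (e.comp V₁)) ζ‖ := by
    rw [PiLp.norm_eq_of_L2, PiLp.norm_eq_of_L2]
    gcongr with p
    have : matOp (x.map fun e => R₂.comp (e.comp V₁)) ζ p = R₂ (matOp x ξ p) := by
      rw [matOp_apply, matOp_apply]
      simp [ζ, h₁]
    rw [this]
    conv_lhs => rw [← h₂ p]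
    exact hV₂ _
  have hpos : 0 < ‖ξ‖ := by
    rw [norm_pos_iff]
    rintro rfl
    simp at hξ
  refine le_of_mul_le_mul_right ?_ hpos
  calc c * ‖ξ‖ ≤ _ := hξ.le.trans hle
    _ ≤ _ := ContinuousLinearMap.le_opNorm _ ζ
    _ ≤ _ := by gcongr

end Compression

/-! ### Embedding `E` into a direct sum of copies of `M_N` -/

section Embedding

variable {H : Type u} [NormedAddCommGroup H] [InnerProductSpace ℂ H]
variable {K : Type v} [NormedAddCommGroup K] [InnerProductSpace ℂ K]

/-- The map `x ↦ matOp x` on `M_N(E)`, as a linear map. -/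
noncomputable def matOpLin (E : Submodule ℂ (B H)) (N : ℕ) :
    Matrix (Fin N) (Fin N) E →ₗ[ℂ] B (HPow N H) where
  toFun x := matOp (x.map fun e => (e : B H))
  map_add' x y := by
    ext ξ i
    simp [matOp_apply, Finset.sum_add_distrib]
  map_smul' c x := by
    ext ξ i
    simp [matOp_apply, Finset.smul_sum]

theorem norm_matOpLin {E : Submodule ℂ (B H)} {N : ℕ} (x : Matrix (Fin N) (Fin N) E) :
    ‖matOpLin E N x‖ = matNorm x := rfl

theorem matOpLin_injective (E : Submodule ℂ (B H)) (N : ℕ) :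
    Function.Injective (matOpLin E N) := by
  rw [injective_iff_map_eq_zero]
  intro x hx
  ext i j v
  have h := congrArg (fun T : B (HPow N H) => T (PiLp.single 2 j v) i) hx
  have h' : ∑ q, (x i q : B H) ((PiLp.single 2 j v : HPow N H) q) = 0 := by
    simpa [matOpLin, matOp_apply] using h
  rw [Finset.sum_eq_single j (fun q _ hq => by simp [hq]) (by simp)] at h'
  simpa using h'

theorem finrank_real_range_matOpLin (E : Submodule ℂ (B H)) (N : ℕ) :
    Module.finrank ℝ (LinearMap.range (matOpLin E N)) = 2 * Module.finrank ℂ E * N ^ 2 := by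
  rw [finrank_real_of_complex, LinearMap.finrank_range_of_inj (matOpLin_injective E N),
    Module.finrank_matrix]
  simp only [Fintype.card_fin]
  ring

theorem matNorm_nonneg {E : Submodule ℂ (B H)} {N : ℕ} (x : Matrix (Fin N) (Fin N) E) :
    0 ≤ matNorm x := norm_nonneg _

theorem matNorm_eq_zero_iff {E : Submodule ℂ (B H)} {N : ℕ} (x : Matrix (Fin N) (Fin N) E) :
    matNorm x = 0 ↔ x = 0 := by
  rw [← norm_matOpLin, norm_eq_zero, map_eq_zero_iff _ (matOpLin_injective E N)]

theorem matNorm_smul {E : Submodule ℂ (B H)} {N : ℕ} (c : ℂ) (x : Matrix (Fin N) (Fin N) E) :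
    matNorm (c • x) = ‖c‖ * matNorm x := by
  rw [← norm_matOpLin, map_smul, norm_smul, norm_matOpLin]

/-- A linear map that distorts the norm of `M_N(E)` by a factor between `c` and `1` shows
that `E` is at distance at most `c⁻¹` from its range. -/
theorem dist_range_le {E : Submodule ℂ (B H)} [FiniteDimensional ℂ E] {N : ℕ} (hN : 1 ≤ N)
    (u : E →ₗ[ℂ] B K) {c : ℝ} (hc : 0 < c)
    (hle : ∀ x : Matrix (Fin N) (Fin N) E, ‖matOp (x.map u)‖ ≤ matNorm x)
    (hge : ∀ x : Matrix (Fin N) (Fin N) E, c * matNorm x ≤ ‖matOp (x.map u)‖) :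
    dist N E (LinearMap.range u) ≤ ENNReal.ofReal c⁻¹ := by
  have hinj : Function.Injective u := by
    rw [injective_iff_map_eq_zero]
    intro e he
    have h := hge (Matrix.of fun _ _ => e)
    have h0 : matOp ((Matrix.of fun _ _ => e : Matrix (Fin N) (Fin N) E).map u) = 0 := by
      ext ξ i
      simp [matOp_apply, he]
    rw [h0, norm_zero] at h
    have h1 : matNorm (Matrix.of fun _ _ => e : Matrix (Fin N) (Fin N) E) = 0 :=
      le_antisymm (nonpos_of_mul_nonpos_right h hc) (norm_nonneg _)
    rw [matNorm_eq_zero_iff] at h1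
    simpa using congrFun (congrFun h1 ⟨0, hN⟩) ⟨0, hN⟩
  let w : E ≃L[ℂ] LinearMap.range u := (LinearEquiv.ofInjective u hinj).toContinuousLinearEquiv
  have hw : ∀ x : Matrix (Fin N) (Fin N) E, matNorm (x.map w) = ‖matOp (x.map u)‖ := fun x => rfl
  refine (iInf_le _ w).trans ?_
  have h1 : ampNorm N (w : E →L[ℂ] LinearMap.range u) ≤ 1 := by
    refine iSup₂_le fun x hx => ?_
    rw [ENNReal.ofReal_le_one]
    exact ((hw x).le.trans (hle x)).trans hx
  have h2 : ampNorm N (w.symm : LinearMap.range u →L[ℂ] E) ≤ ENNReal.ofReal c⁻¹ := by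
    refine iSup₂_le fun y hy => ENNReal.ofReal_le_ofReal ?_
    have hy' : (y.map w.symm).map w = y := by
      ext1 i j
      simp
    have := (hge (y.map w.symm)).trans_eq (hw _).symm
    rw [hy'] at this
    rw [← mul_one c⁻¹, le_inv_mul_iff₀ hc]
    exact this.trans hy
  calc _ ≤ 1 * ENNReal.ofReal c⁻¹ := mul_le_mul' h1 h2
    _ = _ := one_mul _

/-- The direct sum of the compressions `e ↦ R i ∘ e ∘ V i`. -/
noncomputable def compressSum {k : ℕ} (R : Fin k → H →L[ℂ] K) (V : Fin k → K →L[ℂ] H) :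
    B H →ₗ[ℂ] B (HPow k K) where
  toFun e := ((PiLp.continuousLinearEquiv 2 ℂ (fun _ : Fin k => K)).symm :
      (Fin k → K) →L[ℂ] HPow k K).comp
    (ContinuousLinearMap.pi fun i =>
      (R i).comp (e.comp ((V i).comp (PiLp.proj 2 (fun _ : Fin k => K) i))))
  map_add' e f := by
    ext ξ i
    simp
  map_smul' c e := by
    ext ξ i
    simp

theorem compressSum_apply {k : ℕ} (R : Fin k → H →L[ℂ] K) (V : Fin k → K →L[ℂ] H) (e : B H)
    (ξ : HPow k K) (i : Fin k) : compressSum R V e ξ i = R i (e (V i (ξ i))) := by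
  simp [compressSum]

/-- Exchanging the indices in `Fin N` and `Fin k` makes the operator block diagonal, with the
individual compressions as blocks; each is bounded by `‖matOp x‖`. -/
theorem norm_matOp_compressSum_le {k N : ℕ} (R : Fin k → H →L[ℂ] K) (V : Fin k → K →L[ℂ] H)
    (hR : ∀ i x, ‖R i x‖ ≤ ‖x‖) (hV : ∀ i x, ‖V i x‖ ≤ ‖x‖)
    (x : Matrix (Fin N) (Fin N) (B H)) :
    ‖matOp (x.map (compressSum R V))‖ ≤ ‖matOp x‖ := by
  refine ContinuousLinearMap.opNorm_le_bound _ (norm_nonneg _) fun ζ => ?_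
  refine le_of_sq_le_sq ?_ (by positivity)
  let ζ' : Fin k → HPow N K := fun i => WithLp.toLp 2 fun q => ζ q i
  have key : ∀ i p, matOp (x.map (compressSum R V)) ζ p i =
      matOp (x.map fun e => (R i).comp (e.comp (V i))) (ζ' i) p := by
    intro i p
    rw [matOp_apply, matOp_apply]
    simp [compressSum_apply, ζ']
  rw [mul_pow, PiLp.norm_sq_eq_of_L2, PiLp.norm_sq_eq_of_L2]
  simp_rw [PiLp.norm_sq_eq_of_L2 (fun _ : Fin k => K), key]
  rw [Finset.sum_comm, Finset.sum_comm (s := Finset.univ (α := Fin N)), Finset.mul_sum]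
  refine Finset.sum_le_sum fun i _ => ?_
  rw [← PiLp.norm_sq_eq_of_L2]
  have h2 : ∑ q, ‖ζ q i‖ ^ 2 = ‖ζ' i‖ ^ 2 := by
    rw [PiLp.norm_sq_eq_of_L2]
  rw [h2, ← mul_pow]
  gcongr
  refine (ContinuousLinearMap.le_opNorm _ _).trans ?_
  gcongr
  exact norm_matOp_compress_le x (R i) (V i) (hR i) (hV i)

/-- Each summand is recovered from the direct sum by a coordinate inclusion and projection, which
are contractions. -/
theorem norm_matOp_compress_le_compressSum {k N : ℕ} (R : Fin k → H →L[ℂ] K)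
    (V : Fin k → K →L[ℂ] H) (x : Matrix (Fin N) (Fin N) (B H)) (i : Fin k) :
    ‖matOp (x.map fun e => (R i).comp (e.comp (V i)))‖ ≤
      ‖matOp (x.map (compressSum R V))‖ := by
  classical
  let P : HPow k K →L[ℂ] K := PiLp.proj 2 (fun _ : Fin k => K) i
  let J : K →L[ℂ] HPow k K := ((PiLp.continuousLinearEquiv 2 ℂ (fun _ : Fin k => K)).symm :
      (Fin k → K) →L[ℂ] HPow k K).comp (ContinuousLinearMap.single ℂ (fun _ : Fin k => K) i)
  have hJ : ∀ v, J v = PiLp.single 2 i v := fun v => by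
    ext j
    simp [J]
  have h := norm_matOp_compress_le (x.map (compressSum R V)) P J
    (fun ξ => PiLp.norm_apply_le ξ i) (fun v => by rw [hJ, PiLp.norm_single])
  refine le_of_eq_of_le ?_ h
  congr 2
  ext p q v
  simp [P, hJ, compressSum_apply]

theorem compressSum_mem_matSum {N k : ℕ} (R : Fin k → H →L[ℂ] EuclideanSpace ℂ (Fin N))
    (V : Fin k → EuclideanSpace ℂ (Fin N) →L[ℂ] H) (e : B H) :
    compressSum R V e ∈ matSum N k :=
  ⟨fun i => (R i).comp (e.comp (V i)), fun ξ i => compressSum_apply R V e ξ i⟩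

theorem kE_le {E : Submodule ℂ (B H)} {N k : ℕ} {C : ℝ} (hk : 1 ≤ k)
    (F : Submodule ℂ (B (SumSpace N k))) (hF : F ≤ matSum N k)
    (h : dist N E F ≤ ENNReal.ofReal C) : kE E N C ≤ k :=
  iInf₂_le k ⟨hk, F, hF, h⟩

/-- When `E = 0` the unit sphere and its net are empty, while `kE` requires `k ≥ 1`. -/
theorem kE_le_one_of_subsingleton (E : Submodule ℂ (B H)) [Subsingleton E] {N : ℕ}
    (hN : 1 ≤ N) {c : ℝ} (hc : 0 < c) : kE E N c⁻¹ ≤ 1 := by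
  have hx : ∀ x : Matrix (Fin N) (Fin N) E, matNorm x = 0 := fun x =>
    (matNorm_eq_zero_iff x).2 (Subsingleton.elim _ _)
  refine kE_le le_rfl (LinearMap.range (0 : E →ₗ[ℂ] B (SumSpace N 1))) (by simp)
    (dist_range_le hN _ hc (fun x => ?_) fun x => ?_)
  · refine le_of_eq_of_le ?_ (hx x).ge
    rw [norm_eq_zero]
    ext ξ i j
    simp [matOp_apply]
  · rw [hx, mul_zero]
    exact norm_nonneg _

/-- A net of the unit sphere of `M_N(E)` with `k` points embeds `E` into `k` copies of `M_N`. -/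
theorem kE_le_of_net (E : Submodule ℂ (B H)) [FiniteDimensional ℂ E] {N k : ℕ} (hN : 1 ≤ N)
    (hk : 1 ≤ k) {δ r : ℝ} (hδ : δ < 1) (hr : r < δ)
    (z : Fin k → Matrix (Fin N) (Fin N) E) (hz : ∀ i, matNorm (z i) = 1)
    (hnet : ∀ x, matNorm x = 1 → ∃ i, matNorm (x - z i) ≤ r) :
    kE E N (1 - δ)⁻¹ ≤ k := by
  -- The compression at a net point may lose `δ - r`; moving to a point within `r` of it loses at
  -- most `r` more, for a total of `δ`.
  have hex : ∀ i, _ := fun i => exists_compression ((z i).map fun e => (e : B H))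
    (c := 1 - (δ - r)) (by
      change _ < matNorm (z i)
      rw [hz]
      linarith)
  choose R V hR hV hRV using hex
  let u : E →ₗ[ℂ] B (SumSpace N k) := (compressSum R V).comp E.subtype
  have hu : ∀ x : Matrix (Fin N) (Fin N) E,
      x.map u = (x.map fun e => (e : B H)).map (compressSum R V) := fun x => rfl
  have hge1 : ∀ x : Matrix (Fin N) (Fin N) E, matNorm x = 1 → 1 - δ ≤ ‖matOp (x.map u)‖ := by
    intro x hx
    obtain ⟨i, hi⟩ := hnet x hx
    have h1 := norm_matOp_compress_le_compressSum R V (x.map fun e => (e : B H)) i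
    have h2 := norm_matOp_compress_le ((x - z i).map fun e => (e : B H)) (R i) (V i) (hR i) (hV i)
    have h3 : matOp (((x - z i).map fun e => (e : B H)).map fun e => (R i).comp (e.comp (V i))) =
        matOp ((x.map fun e => (e : B H)).map fun e => (R i).comp (e.comp (V i))) -
        matOp (((z i).map fun e => (e : B H)).map fun e => (R i).comp (e.comp (V i))) := by
      ext ξ p
      simp [matOp_apply, Finset.sum_sub_distrib]
    rw [h3] at h2
    have h4 := norm_sub_norm_le
      (matOp (((z i).map fun e => (e : B H)).map fun e => (R i).comp (e.comp (V i))))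
      (matOp ((x.map fun e => (e : B H)).map fun e => (R i).comp (e.comp (V i))))
    rw [norm_sub_rev] at h4
    have h5 : ‖matOp ((x - z i).map fun e => (e : B H))‖ ≤ r := hi
    rw [hu]
    linarith [hRV i]
  refine kE_le hk (LinearMap.range u) ?_ (dist_range_le hN u (by linarith) ?_ ?_)
  · rintro _ ⟨e, rfl⟩
    exact compressSum_mem_matSum R V _
  · exact fun x => norm_matOp_compressSum_le R V hR hV _
  · intro x
    rcases eq_or_ne (matNorm x) 0 with h0 | h0
    · rw [h0, mul_zero]
      exact norm_nonneg _
    have hpos : 0 < matNorm x := lt_of_le_of_ne (norm_nonneg _) h0.symm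
    have hn : ‖((matNorm x : ℂ))⁻¹‖ = (matNorm x)⁻¹ := by
      rw [norm_inv, Complex.norm_real, Real.norm_of_nonneg hpos.le]
    have h1 := hge1 ((matNorm x : ℂ)⁻¹ • x) (by
      rw [matNorm_smul, hn, inv_mul_cancel₀ h0])
    have h2 : matOp (((matNorm x : ℂ)⁻¹ • x).map u) = (matNorm x : ℂ)⁻¹ • matOp (x.map u) := by
      ext1 ξ
      ext1 p
      simp [matOp_apply, Finset.smul_sum]
    rwa [h2, norm_smul, hn, inv_mul_eq_div, le_div_iff₀ hpos] at h1

theorem kE_le_pow (E : Submodule ℂ (B H)) [FiniteDimensional ℂ E] {δ : ℝ} (h0 : 0 < δ)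
    (h1 : δ < 1) {N : ℕ} (hN : 1 ≤ N) :
    (kE E N (1 - δ)⁻¹ : ℝ≥0∞) ≤
      ENNReal.ofReal ((1 + 2 * δ⁻¹) ^ (2 * Module.finrank ℂ E * N ^ 2)) := by
  have hbase : (1 : ℝ) ≤ 1 + 2 * δ⁻¹ := by
    have : 0 < δ⁻¹ := inv_pos.2 h0
    linarith
  rcases subsingleton_or_nontrivial E with hE | hE
  · have h := kE_le_one_of_subsingleton E hN (sub_pos.2 h1)
    calc (kE E N (1 - δ)⁻¹ : ℝ≥0∞) ≤ ((1 : ℕ∞) : ℝ≥0∞) := by exact_mod_cast h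
      _ = ENNReal.ofReal 1 := by simp
      _ ≤ _ := ENNReal.ofReal_le_ofReal (one_le_pow₀ hbase)
  -- `W` is `M_N(E)` with its operator norm, viewed as a real normed space for the volume count.
  let W := LinearMap.range (matOpLin E N)
  obtain ⟨s, r, hr, hs, hnet, hcard⟩ := exists_sphere_net (V := W) h0
  rw [finrank_real_range_matOpLin] at hcard
  have hlift : ∀ c : W, ∃ x, matOpLin E N x = c := fun c => c.2
  choose g hg using hlift
  have hnet' : ∀ x, matNorm x = 1 → ∃ i, matNorm (x - g (s.equivFin.symm i)) ≤ r := by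
    intro x hx
    obtain ⟨c, hc, hcx⟩ := hnet ⟨matOpLin E N x, x, rfl⟩ hx
    refine ⟨s.equivFin ⟨c, hc⟩, ?_⟩
    rw [Equiv.symm_apply_apply, ← norm_matOpLin, map_sub, hg]
    exact hcx
  have hk : 1 ≤ s.card := by
    obtain ⟨e, he⟩ := exists_ne (0 : E)
    let x : Matrix (Fin N) (Fin N) E := Matrix.of fun _ _ => e
    have hx : matNorm x ≠ 0 := fun h => he <| by
      simpa [x] using congrFun (congrFun ((matNorm_eq_zero_iff x).1 h) ⟨0, hN⟩) ⟨0, hN⟩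
    obtain ⟨i, -⟩ := hnet' ((matNorm x : ℂ)⁻¹ • x) (by
      rw [matNorm_smul, norm_inv, Complex.norm_real, Real.norm_of_nonneg (matNorm_nonneg x),
        inv_mul_cancel₀ hx])
    exact Fin.pos i
  have h := kE_le_of_net E hN hk h1 hr (fun i => g (s.equivFin.symm i)) (fun i => by
    rw [← norm_matOpLin, hg]
    exact hs _ (s.equivFin.symm i).2) hnet'
  calc (kE E N (1 - δ)⁻¹ : ℝ≥0∞) ≤ ((s.card : ℕ∞) : ℝ≥0∞) := by exact_mod_cast h
    _ = ENNReal.ofReal s.card := by simp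
    _ ≤ _ := ENNReal.ofReal_le_ofReal hcard

theorem kE_le_exp (E : Submodule ℂ (B H)) [FiniteDimensional ℂ E] {C : ℝ} (hC : 1 < C) {N : ℕ}
    (hN : 1 ≤ N) :
    (kE E N C : ℝ≥0∞) ≤ ENNReal.ofReal
      (Real.exp (2 * Real.log (1 + 2 * (1 - C⁻¹)⁻¹) * Module.finrank ℂ E * N ^ 2)) := by
  have hC' : C⁻¹ < 1 := inv_lt_one_of_one_lt₀ hC
  have hC0 : 0 < C⁻¹ := by positivity
  have h := kE_le_pow E (δ := 1 - C⁻¹) (by linarith) (by linarith) hN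
  rw [sub_sub_cancel, inv_inv] at h
  have hpos : 0 < 1 + 2 * (1 - C⁻¹)⁻¹ := by
    have : 0 < (1 - C⁻¹)⁻¹ := inv_pos.2 (by linarith)
    linarith
  refine h.trans_eq (congrArg _ ?_)
  rw [← Real.exp_log (pow_pos hpos _), Real.log_pow]
  congr 1
  push_cast
  ring

end Embedding

end OpSpace

theorem mainTheorem9 :
    -- the upper bound for every `n`-dimensional operator space
    (∀ (H : Type u) [NormedAddCommGroup H] [InnerProductSpace ℂ H] [CompleteSpace H]
      (E : Submodule ℂ (OpSpace.B H)) [FiniteDimensional ℂ E] (n : ℕ),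
      Module.finrank ℂ E = n →
      ∀ δ : ℝ, 0 < δ → δ < 1 → ∀ N : ℕ, 1 ≤ N →
        (OpSpace.kE E N (1 - δ)⁻¹ : ENNReal) ≤
          ENNReal.ofReal ((1 + 2 * δ⁻¹) ^ (2 * n * N ^ 2))) ∧
    -- the growth in `N` for finite dimensional subspaces of an operator space
    (∀ (H : Type u) [NormedAddCommGroup H] [InnerProductSpace ℂ H] [CompleteSpace H]
      (X : Submodule ℂ (OpSpace.B H)), IsClosed (X : Set (OpSpace.B H)) →
      ∀ E : Submodule ℂ (OpSpace.B H), E ≤ X → FiniteDimensional ℂ E →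
      ∀ C : ℝ, 1 < C →
        Filter.limsup
          (fun N : ℕ => ENNReal.log (OpSpace.kE E N C : ENNReal) / (((N : ℝ) ^ 2 : ℝ) : EReal))
          Filter.atTop < ⊤) ∧
    -- the order `exp (b n N ^ 2)` is the largest possible one, uniformly in `n`, `E` and `N`
    (∀ C : ℝ, 1 < C → ∃ b : ℝ, 0 < b ∧
      ∀ (H : Type u) [NormedAddCommGroup H] [InnerProductSpace ℂ H] [CompleteSpace H]
        (E : Submodule ℂ (OpSpace.B H)) [FiniteDimensional ℂ E] (N : ℕ), 1 ≤ N →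
        (OpSpace.kE E N C : ENNReal) ≤
          ENNReal.ofReal (Real.exp (b * Module.finrank ℂ E * N ^ 2))) := by
  refine ⟨?_, ?_, ?_⟩
  · rintro H _ _ _ E _ n rfl δ h0 h1 N hN
    exact OpSpace.kE_le_pow E h0 h1 hN
  · intro H _ _ _ X _ E _ _ C hC
    set a : ℝ := 2 * Real.log (1 + 2 * (1 - C⁻¹)⁻¹) * Module.finrank ℂ E with ha
    refine lt_of_le_of_lt (b := (a : EReal)) ?_ (EReal.coe_lt_top a)
    refine Filter.limsup_le_of_le (by isBoundedDefault) ?_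
    -- From `N = 1` on the quotient is at most `a`, and dividing by `N²` is legitimate.
    filter_upwards [Filter.eventually_ge_atTop 1] with N hN
    have hN0 : (0 : ℝ) < (N : ℝ) ^ 2 := by positivity
    rw [EReal.div_le_iff_le_mul (by exact_mod_cast hN0) (EReal.coe_ne_top _)]
    refine (ENNReal.log_monotone (OpSpace.kE_le_exp E hC hN)).trans ?_
    rw [ENNReal.log_pos_real' (by rw [ENNReal.toReal_ofReal] <;> positivity),
      ENNReal.toReal_ofReal (Real.exp_nonneg _), Real.log_exp, ← EReal.coe_mul, mul_comm _ a]
  · intro C hC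
    refine ⟨2 * Real.log (1 + 2 * (1 - C⁻¹)⁻¹), ?_, ?_⟩
    · have hC' : C⁻¹ < 1 := inv_lt_one_of_one_lt₀ hC
      have : 0 < (1 - C⁻¹)⁻¹ := inv_pos.2 (by linarith)
      have := Real.log_pos (show 1 < 1 + 2 * (1 - C⁻¹)⁻¹ by linarith)
      linarith
    · intro H _ _ _ E _ N hN
      exact OpSpace.kE_le_exp E hC hN
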